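/- Let $\alpha,\beta,k>0$, $T_{\rm m},L,s_r\in\mathbb R$, and let the controller parameters satisfy $c_1,c_2>0$, $\delta_1>0$, $0<\delta_2<1$. Consider the one-phase Stefan problem with actuator dynamics $$T_t=\alpha T_{xx}\ (t>0,\ 0<x<s(t)),\quad -kT_x(0,t)=q_c(t),\quad T(s(t),t)=T_{\rm m},\quad \dot s(t)=-\beta T_x(s(t),t)\quad(t>0),$$ $$s(0)=s_0,\qquad T(\cdot,0)=T_0,\qquad \dot q_c(t)=U(t),$$ with a given initial flux $q_c(0)$. Put $$h_1(t)=\sigma(t)=-\Big(\tfrac k\alpha\int_0^{s(t)}(T(x,t)-T_{\rm m})\,dx+\tfrac k\beta(s(t)-s_r)\Big),\quad h_2=q_c,\quad h_3=-q_c+c_1\sigma,\quad h(x,t)=T(x,t)-T_{\rm m},$$ $U^*(t)=-c_1h_2(t)+c_2h_3(t)$, $\mu_1=\min\{\delta_1c_1,(1-\delta_2)c_2\}$ and $\bar c_2=(1+\delta_2)c_2$. The control is $U(t)=U^*(t_j)$ for $t\in[t_j,t_{j+1})$, where $t_0=0$ and, as long as $t_j<\infty$, $$t_{j+1}=\inf\Big\{t>t_j:\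 -\delta_2c_2h_3(t)>U^*(t)-U^*(t_j)\ \text{ or }\ U^*(t)-U^*(t_j)>\mu_1h_2(t)+\delta_2c_2h_3(t)\Big\}$$ ($\inf\emptyset=\infty$: no further event; once $t_j=\infty$, all later $t_i$ are $\infty$). The signals in this rule are those of the plant with the input $U^*(t_j)$ held from $t_j$ on, over the times after $t_j$ for which that classical solution exists. Assume that $0<s_0<L$, that $T_0\in C^1([0,s_0];[T_{\rm m},\infty))$ with $T_0(s_0)=T_{\rm m}$, that $q_c(0)\ge0$, that $$s_0+\tfrac\beta\alpha\int_0^{s_0}(T_0(x)-T_{\rm m})\,dx\le s_r<L,$$ and that the gain condition $q_c(0)\le c_1\sigma(0)$ holds (that is, $c_1\ge q_c(0)/\sigma(0)$ if $\sigma(0)>0$). Let $$\tau_1=\frac{-c_1(\mu_1+c_1)+\sqrt{c_1^2(\mu_1+c_1)^2+2\mu_1(1-\delta_2)c_1^2c_2}}{(1-\delta_2)c_1^2c_2},\qquad \tau_2=\frac{-(c_1+\bar c_2)+\sqrt{(c_1+\bar c_2)^2+2\delta_2c_1\bar c_2}}{c_1\bar c_2},\qquad \tau=\min\{\tau_1,\tau_2\}.$$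 Then $\tau>0$; it depends only on $c_1,c_2,\delta_1,\delta_2$ and not on the initial condition. For every classical solution of the closed-loop system, $t_{j+1}\ge t_j+\tau$ for all $j\ge0$. In particular only finitely many events occur in any bounded time interval (no Zeno behavior), and every $t\ge0$ lies in exactly one interval $[t_j,t_{j+1})$. Moreover, at all times $t\ge0$ at which the closed-loop solution is defined (all $t\ge0$ for a global solution), $$h_1(t)\ge0,\qquad h_2(t)=q_c(t)\ge0,\qquad T(x,t)\ge T_{\rm m}\ \text{ for all } x\in(0,s(t)).$$ -/

import Mathlib

open Set

noncomputable section

namespace StefanETC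

/-- Physical constants of the one-phase Stefan model: diffusivity `α`, the constants `β` and `k`,
the melting temperature `Tm`, the length `L` of the material, and the setpoint `sr` for the
interface position. -/
structure Plant where
  α : ℝ
  β : ℝ
  k : ℝ
  Tm : ℝ
  L : ℝ
  sr : ℝ

/-- Parameters of the event-triggered controller. -/
structure Gains where
  c₁ : ℝ
  c₂ : ℝ
  δ₁ : ℝ
  δ₂ : ℝ

/-- Initial data: interface position, temperature profile, boundary heat flux. -/
structure InitialData where
  s₀ : ℝ
  T₀ : ℝ → ℝ
  q₀ : ℝ

/-- The signals of the plant: temperature `T x t`, interface position `s t` and boundary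
heat flux `q t`. Only the values at the times of existence, and for `T` only those with
`0 ≤ x ≤ s t`, are meaningful. -/
structure Trajectory where
  T : ℝ → ℝ → ℝ
  s : ℝ → ℝ
  q : ℝ → ℝ

/-! ### Control barrier functions and the nominal feedback -/

/-- `h₁(t) = σ(t) = -(k/α ∫₀^{s(t)} (T(x,t) - Tm) dx + k/β (s(t) - sr))`. -/
def h₁ (P : Plant) (z : Trajectory) (t : ℝ) : ℝ :=
  -(P.k / P.α * (∫ x in (0 : ℝ)..(z.s t), (z.T x t - P.Tm)) + P.k / P.β * (z.s t - P.sr))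

/-- `h₂(t) = q(t)`. -/
def h₂ (z : Trajectory) (t : ℝ) : ℝ := z.q t

/-- `h₃(t) = -q(t) + c₁ σ(t)`. -/
def h₃ (P : Plant) (G : Gains) (z : Trajectory) (t : ℝ) : ℝ := -z.q t + G.c₁ * h₁ P z t

/-- `h(x,t) = T(x,t) - Tm`. -/
def h (P : Plant) (z : Trajectory) (x t : ℝ) : ℝ := z.T x t - P.Tm

/-- The nonovershooting feedback `U*(t) = -c₁ h₂(t) + c₂ h₃(t)`. -/
def Ustar (P : Plant) (G : Gains) (z : Trajectory) (t : ℝ) : ℝ :=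
  -G.c₁ * h₂ z t + G.c₂ * h₃ P G z t

/-! ### Standing assumptions on the initial data -/

/-- `σ(0)` expressed through the initial data. -/
def InitialData.sigma (P : Plant) (D : InitialData) : ℝ :=
  -(P.k / P.α * (∫ x in (0 : ℝ)..D.s₀, (D.T₀ x - P.Tm)) + P.k / P.β * (D.s₀ - P.sr))

/-- `0 < s₀ < L`, `T₀ ∈ C¹([0,s₀]; [Tm,∞))` and `T₀(s₀) = Tm`. -/
def InitialData.ProfileOK (P : Plant) (D : InitialData) : Prop :=
  0 < D.s₀ ∧ D.s₀ < P.L ∧ ContDiffOn ℝ 1 D.T₀ (Icc 0 D.s₀) ∧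
    (∀ x ∈ Icc 0 D.s₀, P.Tm ≤ D.T₀ x) ∧ D.T₀ D.s₀ = P.Tm

/-- `s₀ + β/α ∫₀^{s₀} (T₀ - Tm) dx ≤ sr < L`. -/
def InitialData.SetpointOK (P : Plant) (D : InitialData) : Prop :=
  D.s₀ + P.β / P.α * (∫ x in (0 : ℝ)..D.s₀, (D.T₀ x - P.Tm)) ≤ P.sr ∧ P.sr < P.L

/-! ### Classical solutions of the Stefan problem -/

/-- The spatial derivative `T_x(x,t)` on `[0, s(t)]`; it is one-sided at the two end points. -/
def Tx (z : Trajectory) (x t : ℝ) : ℝ := derivWithin (fun y => z.T y t) (Icc 0 (z.s t)) x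

/-- The second spatial derivative `T_xx(x,t)`, used for `0 < x < s(t)`. -/
def Txx (z : Trajectory) (x t : ℝ) : ℝ := deriv (fun y => Tx z y t) x

/-- The time derivative `T_t(x,t)`, used for `0 < x < s(t)`. -/
def Tt (z : Trajectory) (x t : ℝ) : ℝ := deriv (fun r => z.T x r) t

/-- The open liquid domain `{(x,t) : 0 < t < E, 0 < x < s(t)}`. -/
def openDomain (z : Trajectory) (E : EReal) : Set (ℝ × ℝ) :=
  {p | 0 < p.2 ∧ (p.2 : EReal) < E ∧ 0 < p.1 ∧ p.1 < z.s p.2}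

/-- The domain `{(x,t) : 0 < t < E, 0 ≤ x ≤ s(t)}`. -/
def lateralDomain (z : Trajectory) (E : EReal) : Set (ℝ × ℝ) :=
  {p | 0 < p.2 ∧ (p.2 : EReal) < E ∧ 0 ≤ p.1 ∧ p.1 ≤ z.s p.2}

/-- The domain `{(x,t) : 0 ≤ t < E, 0 ≤ x ≤ s(t)}`. -/
def closedDomain (z : Trajectory) (E : EReal) : Set (ℝ × ℝ) :=
  {p | 0 ≤ p.2 ∧ (p.2 : EReal) < E ∧ 0 ≤ p.1 ∧ p.1 ≤ z.s p.2}

/-- `(T, s)` is a classical solution, on the time interval `[0, E)` with `E ≤ ∞`, of the one-phase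
Stefan problem driven by the boundary heat flux `q` and started from `(T₀, s₀)`. -/
structure IsClassicalSolution (P : Plant) (D : InitialData) (z : Trajectory) (E : EReal) :
    Prop where
  /-- the liquid phase does not vanish during the lifetime of the solution -/
  s_pos : ∀ t : ℝ, 0 ≤ t → (t : EReal) < E → 0 < z.s t
  s_cont : ContinuousOn z.s {t : ℝ | 0 ≤ t ∧ (t : EReal) < E}
  T_cont : ContinuousOn (fun p : ℝ × ℝ => z.T p.1 p.2) (closedDomain z E)
  T_diff_x : ∀ p ∈ lateralDomain z E,
    DifferentiableWithinAt ℝ (fun y => z.T y p.2) (Icc 0 (z.s p.2)) p.1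
  Tx_cont : ContinuousOn (fun p : ℝ × ℝ => Tx z p.1 p.2) (lateralDomain z E)
  T_diff_t : ∀ p ∈ openDomain z E, DifferentiableAt ℝ (fun r => z.T p.1 r) p.2
  Tt_cont : ContinuousOn (fun p : ℝ × ℝ => Tt z p.1 p.2) (openDomain z E)
  Tx_diff_x : ∀ p ∈ openDomain z E, DifferentiableAt ℝ (fun y => Tx z y p.2) p.1
  Txx_cont : ContinuousOn (fun p : ℝ × ℝ => Txx z p.1 p.2) (openDomain z E)
  /-- heat equation -/
  heat : ∀ p ∈ openDomain z E, Tt z p.1 p.2 = P.α * Txx z p.1 p.2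
  /-- heat flux at the fixed boundary -/
  flux : ∀ t : ℝ, 0 < t → (t : EReal) < E → -P.k * Tx z 0 t = z.q t
  /-- melting temperature at the interface -/
  melt : ∀ t : ℝ, 0 < t → (t : EReal) < E → z.T (z.s t) t = P.Tm
  /-- interface dynamics -/
  interface : ∀ t : ℝ, 0 < t → (t : EReal) < E → HasDerivAt z.s (-P.β * Tx z (z.s t) t) t
  s_init : z.s 0 = D.s₀
  T_init : ∀ x ∈ Ioc 0 D.s₀, z.T x 0 = D.T₀ x

/-! ### The event-triggered closed loop -/

/-- `μ₁ = min {δ₁ c₁, (1 - δ₂) c₂}`. -/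
def Gains.mu₁ (G : Gains) : ℝ := min (G.δ₁ * G.c₁) ((1 - G.δ₂) * G.c₂)

/-- `c̄₂ = (1 + δ₂) c₂`. -/
def Gains.cbar₂ (G : Gains) : ℝ := (1 + G.δ₂) * G.c₂

/-- The condition on the time `t` that calls for a new event, when `a` is the last event time:
with `Ũ*(t) = U*(t) - U*(a)`, either `-δ₂ c₂ h₃(t) > Ũ*(t)` or
`Ũ*(t) > μ₁ h₂(t) + δ₂ c₂ h₃(t)`. -/
def Violates (P : Plant) (G : Gains) (z : Trajectory) (a t : ℝ) : Prop :=
  -G.δ₂ * G.c₂ * h₃ P G z t > Ustar P G z t - Ustar P G z a ∨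
    Ustar P G z t - Ustar P G z a > G.mu₁ * h₂ z t + G.δ₂ * G.c₂ * h₃ P G z t

/-- The data of an execution of the sampled closed loop: the event times `t₀, t₁, …` (with the
value `⊤` from the moment on when no further event occurs) and, for each `j`, the trajectory of
the plant from time `0` on when the samples taken at `t₀, …, t_j` are applied and the last one is
held, with its time interval of existence `[0, life j)`. -/
structure Execution where
  time : ℕ → EReal
  traj : ℕ → Trajectory
  life : ℕ → EReal

/-- The execution obeys the plant equations, the actuator dynamics `q̇ = U`, the zero-order hold
`U(t) = U*(t_j)` and the triggering rule. The `j`-th trajectory is the one on which the trigger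
looks for the event `t_{j+1}`; at `t_{j+1}` the closed loop passes to the next trajectory, which
has the same past. The lifetimes are arbitrary; global executions have
`life j = ⊤` for the last `j` with `t_j < ⊤`, if there is a last one. -/
structure IsClosedLoop (P : Plant) (G : Gains) (D : InitialData) (e : Execution) : Prop where
  time_zero : e.time 0 = 0
  /-- the solution with the newly held input exists at least for a short while -/
  alive : ∀ j, e.time j ≠ ⊤ → e.time j < e.life j
  plant : ∀ j, e.time j ≠ ⊤ → IsClassicalSolution P D (e.traj j) (e.life j)
  flux_init : (e.traj 0).q 0 = D.q₀
  flux_cont : ∀ j, e.time j ≠ ⊤ →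
    ContinuousOn (e.traj j).q {t : ℝ | 0 ≤ t ∧ (t : EReal) < e.life j}
  /-- `q̇(t) = U*(t_j)`, as a right derivative at `t = t_j` -/
  hold : ∀ j, ∀ t : ℝ, e.time j ≤ t → (t : EReal) < e.life j →
    HasDerivWithinAt (e.traj j).q (Ustar P G (e.traj j) (e.time j).toReal) (Ici t) t
  /-- the infimum is `⊤` if the triggering condition is never met -/
  trigger : ∀ j, e.time (j + 1) = sInf ((fun t : ℝ => (t : EReal)) ''
    {t : ℝ | e.time j < t ∧ (t : EReal) < e.life j ∧
      Violates P G (e.traj j) (e.time j).toReal t})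
  /-- up to `t_{j+1}` the next trajectory is the old one -/
  same_past : ∀ j, e.time (j + 1) ≠ ⊤ → ∀ t : ℝ, 0 ≤ t → (t : EReal) ≤ e.time (j + 1) →
    (e.traj (j + 1)).s t = (e.traj j).s t ∧ (e.traj (j + 1)).q t = (e.traj j).q t ∧
      ∀ x ∈ Icc 0 ((e.traj j).s t), (e.traj (j + 1)).T x t = (e.traj j).T x t

/-- `t ∈ [t_j, t_{j+1})`: at time `t` the closed loop runs along the `j`-th trajectory. -/
def Execution.Active (e : Execution) (j : ℕ) (t : ℝ) : Prop :=
  e.time j ≤ t ∧ (t : EReal) < e.time (j + 1)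

/-! ### The dwell time -/

def Gains.tau₁ (G : Gains) : ℝ :=
  (-(G.c₁ * (G.mu₁ + G.c₁)) +
      √(G.c₁ ^ 2 * (G.mu₁ + G.c₁) ^ 2 + 2 * G.mu₁ * (1 - G.δ₂) * G.c₁ ^ 2 * G.c₂)) /
    ((1 - G.δ₂) * G.c₁ ^ 2 * G.c₂)

def Gains.tau₂ (G : Gains) : ℝ :=
  (-(G.c₁ + G.cbar₂) + √((G.c₁ + G.cbar₂) ^ 2 + 2 * G.δ₂ * G.c₁ * G.cbar₂)) /
    (G.c₁ * G.cbar₂)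

/-- `τ = min {τ₁, τ₂}`. -/
def Gains.tau (G : Gains) : ℝ := min G.tau₁ G.tau₂

end StefanETC

end

/-!
Conservation of energy gives `σ' = -q`. While the input `U*(a)` is held, `q` is therefore affine
and `σ` quadratic in time, and `U*(a) + c₁ q(a) = c₂ h₃(a)` makes each of the two trigger margins
a combination of `h₂(a)` and `h₃(a)`. Of the four coefficients two are sums of nonnegative terms
and the other two are concave quadratics, positive at `t = a`, whose positive roots are `τ₁` and
`τ₂`. Hence no event occurs before `a + τ` as long as `h₂(a), h₃(a) ≥ 0`. Conversely, as long as
the trigger is silent, `h₃' ≥ -c̄₂ h₃` and `q' ≥ -(c₁ + μ₁) q`, so that `h₂` and `h₃` remain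
nonnegative up to the next event. Then `h₁ = (h₂ + h₃) / c₁ ≥ 0`, and since `q ≥ 0` means that no
heat is extracted at `x = 0`, the minimum principle gives `T ≥ Tm`.

The derivative of `σ` is computed in the variable `y = x / s(t)`, in which the heat content is an
integral over `[0, 1]`.
-/

namespace StefanETC

open MeasureTheory Filter Topology

section ParametricIntegral

variable {F : Type*} [NormedAddCommGroup F] [NormedSpace ℝ F]

theorem continuousOn_intervalIntegral_of_continuousOn {X : Type*} [TopologicalSpace X]
    {w : ℝ → X → F} {c d : ℝ} {S : Set X}
    (hw : ContinuousOn (Function.uncurry w) (uIcc c d ×ˢ S)) :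
    ContinuousOn (fun t => ∫ y in c..d, w y t) S := by
  let clamp (y : ℝ) : ℝ := projIcc (min c d) (max c d) min_le_max y
  have hclamp : Continuous clamp := continuous_subtype_val.comp continuous_projIcc
  have hcont : Continuous (Function.uncurry fun (t : S) y => w (clamp y) t) :=
    hw.comp_continuous (f := fun p : S × ℝ => (clamp p.2, (p.1 : X))) (by fun_prop)
      fun p => ⟨Subtype.coe_prop _, p.1.2⟩
  rw [continuousOn_iff_continuous_domRestrict]
  refine (intervalIntegral.continuous_parametric_intervalIntegral_of_continuous' (μ := volume)
    hcont c d).congr fun t => intervalIntegral.integral_congr fun y hy => ?_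
  simp only [clamp, projIcc_of_mem _ hy]

theorem hasDerivAt_intervalIntegral_of_continuousOn {w w' : ℝ → ℝ → F} {c d : ℝ} {U : Set ℝ}
    (hU : IsOpen U) (hw : ContinuousOn (Function.uncurry w) (uIcc c d ×ˢ U))
    (hw' : ContinuousOn (Function.uncurry w') (uIcc c d ×ˢ U))
    (hd : ∀ y ∈ uIcc c d, ∀ r ∈ U, HasDerivAt (w y) (w' y r) r) {t : ℝ} (ht : t ∈ U) :
    HasDerivAt (fun r => ∫ y in c..d, w y r) (∫ y in c..d, w' y t) t := by
  have slice {f : ℝ → ℝ → F} (hf : ContinuousOn (Function.uncurry f) (uIcc c d ×ˢ U)) {r : ℝ}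
      (hr : r ∈ U) : IntervalIntegrable (fun y => f y r) volume c d :=
    (hf.comp (f := fun y => (y, r)) (by fun_prop) fun _ hy => ⟨hy, hr⟩).intervalIntegrable
  obtain ⟨K, ⟨hKt, hK⟩, hKU⟩ := (compact_basis_nhds t).mem_iff.1 (hU.mem_nhds ht)
  obtain ⟨C, hC⟩ := (isCompact_uIcc.prod hK).exists_bound_of_continuousOn
    (hw'.mono (prod_mono_right hKU))
  refine (intervalIntegral.hasDerivAt_integral_of_dominated_loc_of_deriv_le
    (F := fun r y => w y r) (F' := fun r y => w' y r) (bound := fun _ => C) hKt ?_ (slice hw ht)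
    (slice hw' ht).aestronglyMeasurable_restrict_uIoc ?_ intervalIntegrable_const ?_).2
  · filter_upwards [hU.mem_nhds ht] with r hr
    exact (slice hw hr).aestronglyMeasurable_restrict_uIoc
  · exact Eventually.of_forall fun y hy r hr => hC (y, r) ⟨uIoc_subset_uIcc hy, hr⟩
  · exact Eventually.of_forall fun y hy r hr => hd y (uIoc_subset_uIcc hy) r (hKU hr)

theorem tendstoLocallyUniformlyOn_of_continuousOn_uncurry {ι X Y Z : Type*} [TopologicalSpace X]
    [TopologicalSpace Y] [UniformSpace Z] {g : X → Y → Z} {A : Set X} {U : Set Y}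
    (hg : ContinuousOn (Function.uncurry g) (A ×ˢ U)) {l : Filter ι} {φ : ι → X} {c : X}
    (hc : c ∈ A) (hφ : Tendsto φ l (𝓝[A] c)) :
    TendstoLocallyUniformlyOn (fun i => g (φ i)) (g c) l U := by
  refine tendstoLocallyUniformlyOn_iff_forall_tendsto.2 fun t ht => ?_
  have hgt : Tendsto (Function.uncurry g) (𝓝[A] c ×ˢ 𝓝[U] t) (𝓝 (g c t)) := by
    rw [← nhdsWithin_prod_eq]
    exact hg (c, t) ⟨hc, ht⟩
  have hconst : Tendsto (fun _ : ι => c) l (𝓝[A] c) :=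
    tendsto_const_nhdsWithin hc
  have hmoving := hgt.comp (hφ.prodMap (tendsto_id (x := 𝓝[U] t)))
  have hfixed := hgt.comp (hconst.prodMap (tendsto_id (x := 𝓝[U] t)))
  exact ((hfixed.prodMk hmoving).mono_right (nhds_prod_eq.symm.le)).mono_right
    (nhds_le_uniformity (g c t))

theorem tendsto_intervalIntegral_of_intervalIntegrable {f : ℝ → F} {c d : ℝ}
    (hf : IntervalIntegrable f volume c d) :
    Tendsto (fun p : ℝ × ℝ => ∫ y in p.1..p.2, f y) (𝓝[uIcc c d] c ×ˢ 𝓝[uIcc c d] d)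
      (𝓝 (∫ y in c..d, f y)) := by
  have hprim := intervalIntegral.continuousOn_primitive_interval' hf left_mem_uIcc
  have hlim := ((hprim d right_mem_uIcc).tendsto.comp tendsto_snd).sub
    ((hprim c left_mem_uIcc).tendsto.comp (tendsto_fst (g := 𝓝[uIcc c d] d)))
  rw [intervalIntegral.integral_same, sub_zero] at hlim
  refine hlim.congr' ?_
  filter_upwards [prod_mem_prod self_mem_nhdsWithin self_mem_nhdsWithin] with p hp
  have hint {x : ℝ} (hx : x ∈ uIcc c d) : IntervalIntegrable f volume c x :=
    hf.mono_set (uIcc_subset_uIcc_left hx)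
  exact intervalIntegral.integral_interval_sub_left (hint hp.2) (hint hp.1)

/- The common value `w'` of `∂ₜ w` and `∂_y g` need not extend continuously to `y = c` and `y = d`,
so the identity is first obtained on `[a, b] ⊆ (c, d)`, and the limit `a → c`, `b → d` is taken
locally uniformly in time. -/
theorem hasDerivAt_intervalIntegral_of_conservationLaw [CompleteSpace F] {w g w' : ℝ → ℝ → F}
    {c d : ℝ} (hcd : c < d) {U : Set ℝ} (hU : IsOpen U)
    (hw : ContinuousOn (Function.uncurry w) (Icc c d ×ˢ U))
    (hg : ContinuousOn (Function.uncurry g) (Icc c d ×ˢ U))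
    (hw' : ContinuousOn (Function.uncurry w') (Ioo c d ×ˢ U))
    (hwt : ∀ y ∈ Ioo c d, ∀ r ∈ U, HasDerivAt (w y) (w' y r) r)
    (hgy : ∀ y ∈ Ioo c d, ∀ r ∈ U, HasDerivAt (fun x => g x r) (w' y r) y)
    {t : ℝ} (ht : t ∈ U) :
    HasDerivAt (fun r => ∫ y in c..d, w y r) (g d t - g c t) t := by
  have hinner {a b : ℝ} (ha : a ∈ Ioo c d) (hb : b ∈ Ioo c d) {r : ℝ} (hr : r ∈ U) :
      HasDerivAt (fun r => ∫ y in a..b, w y r) (g b r - g a r) r := by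
    have hab : uIcc a b ⊆ Ioo c d := ordConnected_Ioo.uIcc_subset ha hb
    have hw'ab := hw'.mono (prod_mono_left (t := U) hab)
    rw [← intervalIntegral.integral_eq_sub_of_hasDerivAt (f := fun y => g y r)
      (fun y hy => hgy y (hab hy) r hr)
      (hw'ab.comp (f := fun y => (y, r)) (by fun_prop) fun _ hy => ⟨hy, hr⟩).intervalIntegrable]
    exact hasDerivAt_intervalIntegral_of_continuousOn hU
      (hw.mono (prod_mono_left (hab.trans Ioo_subset_Icc_self))) hw'ab
      (fun y hy => hwt y (hab hy)) hr
  have hleft : Tendsto Prod.fst (𝓝[Ioo c d] c ×ˢ 𝓝[Ioo c d] d) (𝓝[Icc c d] c) :=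
    tendsto_fst.mono_right (nhdsWithin_mono c Ioo_subset_Icc_self)
  have hright : Tendsto Prod.snd (𝓝[Ioo c d] c ×ˢ 𝓝[Ioo c d] d) (𝓝[Icc c d] d) :=
    tendsto_snd.mono_right (nhdsWithin_mono d Ioo_subset_Icc_self)
  have := left_nhdsWithin_Ioo_neBot hcd
  have := right_nhdsWithin_Ioo_neBot hcd
  refine hasDerivAt_of_tendstoLocallyUniformlyOn hU (l := 𝓝[Ioo c d] c ×ˢ 𝓝[Ioo c d] d)
    (f := fun p r => ∫ y in p.1..p.2, w y r) (f' := fun p r => g p.2 r - g p.1 r)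
    ((tendstoLocallyUniformlyOn_of_continuousOn_uncurry hg (right_mem_Icc.2 hcd.le) hright).sub
      (tendstoLocallyUniformlyOn_of_continuousOn_uncurry hg (left_mem_Icc.2 hcd.le) hleft))
    ?_ (fun r hr => ?_) ht
  · filter_upwards [prod_mem_prod self_mem_nhdsWithin self_mem_nhdsWithin] with p hp r hr
    exact hinner hp.1 hp.2 hr
  · rw [← uIcc_of_le hcd.le] at hw hleft hright
    exact (tendsto_intervalIntegral_of_intervalIntegrable (hw.comp (f := fun y => (y, r))
      (by fun_prop) fun _ hy => ⟨hy, hr⟩).intervalIntegrable).comp (hleft.prodMk hright)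

end ParametricIntegral

section RealDerivatives

theorem nonneg_of_isLocalMinOn_Ici {f : ℝ → ℝ} {f' a : ℝ}
    (hf : HasDerivWithinAt f f' (Ici a) a) (hmin : IsLocalMinOn f (Ici a) a) : 0 ≤ f' := by
  have hcone : (1 : ℝ) ∈ posTangentConeAt (Ici a) a := by
    refine mem_posTangentConeAt_of_segment_subset ?_
    exact (convex_Ici a).segment_subset self_mem_Ici (by simp)
  simpa using hmin.hasFDerivWithinAt_nonneg hf.hasFDerivWithinAt hcone

theorem nonpos_of_isLocalMinOn_Iic {f : ℝ → ℝ} {f' a : ℝ}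
    (hf : HasDerivWithinAt f f' (Iic a) a) (hmin : IsLocalMinOn f (Iic a) a) : f' ≤ 0 := by
  have hcone : (-1 : ℝ) ∈ posTangentConeAt (Iic a) a := by
    refine mem_posTangentConeAt_of_segment_subset ?_
    exact (convex_Iic a).segment_subset self_mem_Iic (by simp)
  simpa using hmin.hasFDerivWithinAt_nonneg hf.hasFDerivWithinAt hcone

theorem deriv_deriv_nonneg_of_isLocalMin {f : ℝ → ℝ} {x : ℝ} (hmin : IsLocalMin f x)
    (hc : ContinuousAt f x) : 0 ≤ deriv (deriv f) x := by
  by_contra! hneg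
  have hmax := isLocalMax_of_deriv_deriv_neg hneg hmin.deriv_eq_zero hc
  have hconst : f =ᶠ[𝓝 x] fun _ => f x := by
    filter_upwards [hmin, hmax] with y hge hle using le_antisymm hle hge
  have hzero : deriv (deriv f) x = 0 := by simpa using hconst.deriv.deriv_eq
  exact hneg.ne hzero

theorem eq_quadratic_of_hasDerivWithinAt_right {F : Type*} [NormedAddCommGroup F] [NormedSpace ℝ F]
    [CompleteSpace F] {f : ℝ → F} {a b : ℝ} {u v : F} (hab : a ≤ b)
    (hc : ContinuousOn f (Icc a b))
    (hd : ∀ x ∈ Ioo a b, HasDerivWithinAt f (u + (x - a) • v) (Ioi x) x) :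
    f b = f a + (b - a) • u + ((b - a) ^ 2 / 2) • v := by
  have hint := intervalIntegral.integral_eq_sub_of_hasDeriv_right_of_le hab hc hd
    (Continuous.intervalIntegrable (by fun_prop) a b)
  have hlin : ∫ x in a..b, (x - a) = (b - a) ^ 2 / 2 := by
    simp [intervalIntegral.integral_comp_sub_right (fun x => x)]
  rw [intervalIntegral.integral_add (by simp)
    (Continuous.intervalIntegrable (by fun_prop) a b), intervalIntegral.integral_const,
    intervalIntegral.integral_smul_const, hlin] at hint
  rw [add_assoc, hint, add_sub_cancel]

theorem nonneg_of_neg_mul_le_deriv {f f' : ℝ → ℝ} {a b c : ℝ} (hab : a ≤ b)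
    (hc : ContinuousOn f (Icc a b)) (hd : ∀ x ∈ Ioo a b, HasDerivAt f (f' x) x)
    (hge : ∀ x ∈ Ioo a b, -c * f x ≤ f' x) (ha : 0 ≤ f a) : 0 ≤ f b := by
  have hd' : ∀ x ∈ Ioo a b, HasDerivAt (fun x => f x * Real.exp (c * x))
      ((f' x + c * f x) * Real.exp (c * x)) x := fun x hx =>
    ((hd x hx).mul ((hasDerivAt_id x).const_mul c).exp).congr_deriv (by simp only [id]; ring)
  have hmono : MonotoneOn (fun x => f x * Real.exp (c * x)) (Icc a b) := by
    refine monotoneOn_of_deriv_nonneg (convex_Icc a b) (hc.mul (by fun_prop)) ?_ ?_ <;>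
      rw [interior_Icc] <;> intro x hx
    · exact (hd' x hx).differentiableAt.differentiableWithinAt
    · rw [(hd' x hx).deriv]
      exact mul_nonneg (by linarith [hge x hx]) (Real.exp_pos _).le
  have hfb : 0 ≤ f b * Real.exp (c * b) :=
    (mul_nonneg ha (Real.exp_pos _).le).trans (hmono (left_mem_Icc.2 hab) (right_mem_Icc.2 hab) hab)
  exact nonneg_of_mul_nonneg_left hfb (Real.exp_pos _)

end RealDerivatives

section StraightenedDomain

/-- The times `0 ≤ t < E`. -/
def lifetime (E : EReal) : Set ℝ := {t | 0 ≤ t ∧ (t : EReal) < E}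

/-- The times `0 < t < E`. -/
def openLifetime (E : EReal) : Set ℝ := {t | 0 < t ∧ (t : EReal) < E}

/-- The map `(y, t) ↦ (s(t) y, t)`, which fixes the moving interface: it sends the cylinder
`[0, 1] × [0, E)` onto the liquid domain. -/
def straighten (z : Trajectory) (p : ℝ × ℝ) : ℝ × ℝ := (z.s p.2 * p.1, p.2)

/-- The density of the heat content `∫₀^{s(t)} (T - Tm) dx` in the variable `y = x / s(t)`. -/
def heatDensity (P : Plant) (z : Trajectory) (y t : ℝ) : ℝ :=
  z.s t * (z.T (z.s t * y) t - P.Tm)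

/-- The flux of heat through a point of fixed `y = x / s(t)`: what the moving point sweeps over,
with velocity `ṡ(t) y`, and what is conducted. -/
noncomputable def heatFlux (P : Plant) (z : Trajectory) (y t : ℝ) : ℝ :=
  (-P.β * Tx z (z.s t) t) * (y * (z.T (z.s t * y) t - P.Tm)) + P.α * Tx z (z.s t * y) t

/-- The common value of the time derivative of `heatDensity` and the `y`-derivative of
`heatFlux`. -/
noncomputable def heatRate (P : Plant) (z : Trajectory) (y t : ℝ) : ℝ :=
  (-P.β * Tx z (z.s t) t) * ((z.T (z.s t * y) t - P.Tm) + y * (z.s t * Tx z (z.s t * y) t)) +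
    P.α * (z.s t * Txx z (z.s t * y) t)

theorem mem_lifetime_of_le {E : EReal} {r t : ℝ} (ht : (t : EReal) < E) (hr : 0 ≤ r)
    (hrt : r ≤ t) : r ∈ lifetime E :=
  ⟨hr, (EReal.coe_le_coe_iff.2 hrt).trans_lt ht⟩

theorem openLifetime_subset_lifetime (E : EReal) : openLifetime E ⊆ lifetime E :=
  fun _ ht => ⟨ht.1.le, ht.2⟩

theorem isOpen_openLifetime (E : EReal) : IsOpen (openLifetime E) :=
  isOpen_Ioi.inter (isOpen_Iio.preimage continuous_coe_real_ereal)

theorem openDomain_subset_lateralDomain (z : Trajectory) (E : EReal) :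
    openDomain z E ⊆ lateralDomain z E :=
  fun _ hp => ⟨hp.1, hp.2.1, hp.2.2.1.le, hp.2.2.2.le⟩

theorem lateralDomain_subset_closedDomain (z : Trajectory) (E : EReal) :
    lateralDomain z E ⊆ closedDomain z E :=
  fun _ hp => ⟨hp.1.le, hp.2⟩

theorem integral_sub_Tm_eq_integral_heatDensity (P : Plant) (z : Trajectory) (t : ℝ) :
    ∫ x in (0 : ℝ)..(z.s t), (z.T x t - P.Tm) = ∫ y in (0 : ℝ)..1, heatDensity P z y t := by
  simp only [heatDensity]
  rw [intervalIntegral.integral_const_mul,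
    intervalIntegral.mul_integral_comp_mul_left (f := fun x => z.T x t - P.Tm), mul_zero, mul_one]

theorem h₁_congr (P : Plant) {z z' : Trajectory} {t : ℝ} (hs : z'.s t = z.s t)
    (hT : ∀ x ∈ uIcc 0 (z.s t), z'.T x t = z.T x t) : h₁ P z' t = h₁ P z t := by
  have hint : ∫ x in (0 : ℝ)..(z.s t), (z'.T x t - P.Tm) =
      ∫ x in (0 : ℝ)..(z.s t), (z.T x t - P.Tm) :=
    intervalIntegral.integral_congr fun x hx => congrArg (· - P.Tm) (hT x hx)
  simp only [h₁, hs, hint]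

end StraightenedDomain

namespace IsClassicalSolution

variable {P : Plant} {D : InitialData} {z : Trajectory} {E : EReal}

theorem openDomain_mem_nhds (hz : IsClassicalSolution P D z E) {p : ℝ × ℝ}
    (hp : p ∈ openDomain z E) : openDomain z E ∈ 𝓝 p := by
  obtain ⟨h0, hE, hx, hxs⟩ := hp
  have hs : ContinuousAt (fun q : ℝ × ℝ => z.s q.2) p :=
    ((hz.interface p.2 h0 hE).continuousAt).comp (f := Prod.snd) continuousAt_snd
  filter_upwards [continuousAt_snd.preimage_mem_nhds ((isOpen_openLifetime E).mem_nhds ⟨h0, hE⟩),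
    continuousAt_fst.eventually (lt_mem_nhds hx), continuousAt_fst.eventually_lt hs hxs]
    with q hlife hpos hlt using ⟨hlife.1, hlife.2, hpos, hlt⟩

theorem hasDerivAt_T_x (hz : IsClassicalSolution P D z E) {p : ℝ × ℝ}
    (hp : p ∈ openDomain z E) : HasDerivAt (fun y => z.T y p.2) (Tx z p.1 p.2) p.1 :=
  (hz.T_diff_x p (openDomain_subset_lateralDomain z E hp)).hasDerivWithinAt.hasDerivAt
    (Icc_mem_nhds hp.2.2.1 hp.2.2.2)

theorem hasFDerivAt_T (hz : IsClassicalSolution P D z E) {p : ℝ × ℝ}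
    (hp : p ∈ openDomain z E) :
    HasFDerivAt (fun q : ℝ × ℝ => z.T q.1 q.2)
      ((ContinuousLinearMap.toSpanSingleton ℝ (Tx z p.1 p.2)).coprod
        (ContinuousLinearMap.toSpanSingleton ℝ (Tt z p.1 p.2))) p := by
  have hnhds := hz.openDomain_mem_nhds hp
  have hspan : Continuous fun c : ℝ => ContinuousLinearMap.toSpanSingleton ℝ c :=
    (ContinuousLinearMap.toSpanSingletonCLE (𝕜 := ℝ) (E := ℝ)).continuous
  refine (hasStrictFDerivAt_uncurry_coprod (𝕜 := ℝ) (u := p) (f := z.T)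
    (f₁ := fun x t => ContinuousLinearMap.toSpanSingleton ℝ (Tx z x t))
    (f₂ := fun x t => ContinuousLinearMap.toSpanSingleton ℝ (Tt z x t)) ?_ ?_ ?_ ?_).hasFDerivAt
  · filter_upwards [hnhds] with q hq using (hz.hasDerivAt_T_x hq).hasFDerivAt
  · filter_upwards [hnhds] with q hq using (hz.T_diff_t q hq).hasDerivAt.hasFDerivAt
  · exact hspan.continuousAt.comp (f := fun q : ℝ × ℝ => Tx z q.1 q.2)
      ((hz.Tx_cont.mono (openDomain_subset_lateralDomain z E)).continuousAt hnhds)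
  · exact hspan.continuousAt.comp (f := fun q : ℝ × ℝ => Tt z q.1 q.2)
      (hz.Tt_cont.continuousAt hnhds)

theorem continuousOn_s_snd (hz : IsClassicalSolution P D z E) (A : Set ℝ) :
    ContinuousOn (fun p : ℝ × ℝ => z.s p.2) (A ×ˢ lifetime E) :=
  hz.s_cont.comp (f := Prod.snd) continuousOn_snd fun _ hp => hp.2

theorem continuousOn_straighten (hz : IsClassicalSolution P D z E) (A : Set ℝ) :
    ContinuousOn (straighten z) (A ×ˢ lifetime E) :=
  ((hz.continuousOn_s_snd A).mul continuousOn_fst).prodMk continuousOn_snd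

theorem mapsTo_straighten_closedDomain (hz : IsClassicalSolution P D z E) :
    MapsTo (straighten z) (Icc 0 1 ×ˢ lifetime E) (closedDomain z E) := fun p hp =>
  have hs := (hz.s_pos p.2 hp.2.1 hp.2.2).le
  ⟨hp.2.1, hp.2.2, mul_nonneg hs hp.1.1, mul_le_of_le_one_right hs hp.1.2⟩

theorem mapsTo_straighten_lateralDomain (hz : IsClassicalSolution P D z E) :
    MapsTo (straighten z) (Icc 0 1 ×ˢ openLifetime E) (lateralDomain z E) := fun _ hp =>
  ⟨hp.2.1, (hz.mapsTo_straighten_closedDomain ⟨hp.1, openLifetime_subset_lifetime E hp.2⟩).2⟩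

theorem mapsTo_straighten_openDomain (hz : IsClassicalSolution P D z E) :
    MapsTo (straighten z) (Ioo 0 1 ×ˢ openLifetime E) (openDomain z E) := fun p hp =>
  have hs := hz.s_pos p.2 hp.2.1.le hp.2.2
  ⟨hp.2.1, hp.2.2, mul_pos hs hp.1.1, mul_lt_of_lt_one_right hs hp.1.2⟩

theorem continuousOn_heatDensity (hz : IsClassicalSolution P D z E) :
    ContinuousOn (Function.uncurry (heatDensity P z)) (Icc 0 1 ×ˢ lifetime E) :=
  (hz.continuousOn_s_snd _).mul
    ((hz.T_cont.comp (hz.continuousOn_straighten _) hz.mapsTo_straighten_closedDomain).sub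
      continuousOn_const)

theorem continuousOn_T_straighten (hz : IsClassicalSolution P D z E) :
    ContinuousOn (fun p : ℝ × ℝ => z.T (z.s p.2 * p.1) p.2) (Icc 0 1 ×ˢ openLifetime E) :=
  hz.T_cont.comp
    ((hz.continuousOn_straighten _).mono (prod_mono_right (openLifetime_subset_lifetime E)))
    fun _ hp => lateralDomain_subset_closedDomain z E (hz.mapsTo_straighten_lateralDomain hp)

theorem continuousOn_Tx_straighten (hz : IsClassicalSolution P D z E) :
    ContinuousOn (fun p : ℝ × ℝ => Tx z (z.s p.2 * p.1) p.2) (Icc 0 1 ×ˢ openLifetime E) :=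
  hz.Tx_cont.comp
    ((hz.continuousOn_straighten _).mono (prod_mono_right (openLifetime_subset_lifetime E)))
    hz.mapsTo_straighten_lateralDomain

theorem continuousOn_interfaceVelocity (hz : IsClassicalSolution P D z E) (A : Set ℝ) :
    ContinuousOn (fun p : ℝ × ℝ => -P.β * Tx z (z.s p.2) p.2) (A ×ˢ openLifetime E) := by
  refine continuousOn_const.mul ((hz.continuousOn_Tx_straighten.comp
    (f := fun p : ℝ × ℝ => ((1 : ℝ), p.2)) (by fun_prop)
    fun p hp => ⟨right_mem_Icc.2 zero_le_one, hp.2⟩).congr fun p _ => ?_)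
  simp only [Function.comp_apply, mul_one]

theorem continuousOn_heatFlux (hz : IsClassicalSolution P D z E) :
    ContinuousOn (Function.uncurry (heatFlux P z)) (Icc 0 1 ×ˢ openLifetime E) :=
  ((hz.continuousOn_interfaceVelocity _).mul
    (continuousOn_fst.mul (hz.continuousOn_T_straighten.sub continuousOn_const))).add
    (continuousOn_const.mul hz.continuousOn_Tx_straighten)

theorem continuousOn_heatRate (hz : IsClassicalSolution P D z E) :
    ContinuousOn (Function.uncurry (heatRate P z)) (Ioo 0 1 ×ˢ openLifetime E) := by
  have hsub : Ioo (0 : ℝ) 1 ×ˢ openLifetime E ⊆ Icc 0 1 ×ˢ openLifetime E :=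
    prod_mono_left Ioo_subset_Icc_self
  have hlife : Ioo (0 : ℝ) 1 ×ˢ openLifetime E ⊆ Ioo 0 1 ×ˢ lifetime E :=
    prod_mono_right (openLifetime_subset_lifetime E)
  have hs := (hz.continuousOn_s_snd (Ioo 0 1)).mono hlife
  have hT := hz.continuousOn_T_straighten.mono hsub
  have hTx := hz.continuousOn_Tx_straighten.mono hsub
  have hTxx : ContinuousOn (fun p : ℝ × ℝ => Txx z (z.s p.2 * p.1) p.2)
      (Ioo 0 1 ×ˢ openLifetime E) :=
    hz.Txx_cont.comp ((hz.continuousOn_straighten _).mono hlife) hz.mapsTo_straighten_openDomain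
  exact ((hz.continuousOn_interfaceVelocity _).mul
    ((hT.sub continuousOn_const).add (continuousOn_fst.mul (hs.mul hTx)))).add
    (continuousOn_const.mul (hs.mul hTxx))

theorem hasDerivAt_heatDensity (hz : IsClassicalSolution P D z E) {y t : ℝ} (hy : y ∈ Ioo 0 1)
    (ht : t ∈ openLifetime E) : HasDerivAt (heatDensity P z y) (heatRate P z y t) t := by
  have hp : (z.s t * y, t) ∈ openDomain z E :=
    hz.mapsTo_straighten_openDomain (x := (y, t)) ⟨hy, ht⟩
  have hs := hz.interface t ht.1 ht.2
  have hT := (hz.hasFDerivAt_T hp).comp_hasDerivAt (f := fun r => (z.s r * y, r)) t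
    ((hs.mul_const y).prodMk (hasDerivAt_id t))
  refine (hs.mul (hT.sub_const P.Tm)).congr_deriv ?_
  have hheat : Tt z (z.s t * y) t = P.α * Txx z (z.s t * y) t := hz.heat _ hp
  simp only [heatRate, ContinuousLinearMap.coprod_apply,
    ContinuousLinearMap.toSpanSingleton_apply, smul_eq_mul, Function.comp_apply, hheat]
  ring

theorem hasDerivAt_heatFlux (hz : IsClassicalSolution P D z E) {y t : ℝ} (hy : y ∈ Ioo 0 1)
    (ht : t ∈ openLifetime E) :
    HasDerivAt (fun x => heatFlux P z x t) (heatRate P z y t) y := by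
  have hp : (z.s t * y, t) ∈ openDomain z E :=
    hz.mapsTo_straighten_openDomain (x := (y, t)) ⟨hy, ht⟩
  have hlin : HasDerivAt (fun x => z.s t * x) (z.s t) y := hasDerivAt_const_mul (z.s t)
  have hT := HasDerivAt.comp y (h := fun x => z.s t * x) (hz.hasDerivAt_T_x hp) hlin
  have hTx := HasDerivAt.comp y (h := fun x => z.s t * x) (hz.Tx_diff_x _ hp).hasDerivAt hlin
  refine ((((hasDerivAt_id y).mul (hT.sub_const P.Tm)).const_mul
    (-P.β * Tx z (z.s t) t)).add (hTx.const_mul P.α)).congr_deriv ?_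
  simp only [heatRate, Function.comp_apply, id, Txx]
  ring

theorem hasDerivAt_integral_sub_Tm (hz : IsClassicalSolution P D z E) {t : ℝ}
    (ht : t ∈ openLifetime E) :
    HasDerivAt (fun r => ∫ x in (0 : ℝ)..(z.s r), (z.T x r - P.Tm))
      (P.α * (Tx z (z.s t) t - Tx z 0 t)) t := by
  have hsub := prod_mono_right (s := Icc (0 : ℝ) 1) (openLifetime_subset_lifetime E)
  have hcons := hasDerivAt_intervalIntegral_of_conservationLaw zero_lt_one (isOpen_openLifetime E)
    (hz.continuousOn_heatDensity.mono hsub) hz.continuousOn_heatFlux hz.continuousOn_heatRate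
    (fun _ hy _ hr => hz.hasDerivAt_heatDensity hy hr)
    (fun _ hy _ hr => hz.hasDerivAt_heatFlux hy hr) ht
  simp only [integral_sub_Tm_eq_integral_heatDensity]
  refine hcons.congr_deriv ?_
  simp only [heatFlux, mul_one, mul_zero, zero_mul, hz.melt t ht.1 ht.2]
  ring

theorem hasDerivAt_h₁ (hz : IsClassicalSolution P D z E) (hα : P.α ≠ 0) (hβ : P.β ≠ 0) {t : ℝ}
    (ht : t ∈ openLifetime E) : HasDerivAt (h₁ P z) (-z.q t) t := by
  refine (((hz.hasDerivAt_integral_sub_Tm ht).const_mul (P.k / P.α)).add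
    (((hz.interface t ht.1 ht.2).sub_const P.sr).const_mul (P.k / P.β))).neg.congr_deriv ?_
  rw [← hz.flux t ht.1 ht.2]
  field_simp
  ring

theorem continuousOn_h₁ (hz : IsClassicalSolution P D z E) :
    ContinuousOn (h₁ P z) (lifetime E) := by
  have hheat : ContinuousOn (fun t => ∫ x in (0 : ℝ)..(z.s t), (z.T x t - P.Tm)) (lifetime E) := by
    simp only [integral_sub_Tm_eq_integral_heatDensity]
    exact continuousOn_intervalIntegral_of_continuousOn
      (uIcc_of_le (zero_le_one (α := ℝ)) ▸ hz.continuousOn_heatDensity)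
  exact ((continuousOn_const.mul hheat).add
    (continuousOn_const.mul (hz.s_cont.sub continuousOn_const))).neg

theorem h₁_zero (hz : IsClassicalSolution P D z E) (hs₀ : 0 ≤ D.s₀) :
    h₁ P z 0 = D.sigma P := by
  have hint : ∫ x in (0 : ℝ)..D.s₀, (z.T x 0 - P.Tm) = ∫ x in (0 : ℝ)..D.s₀, (D.T₀ x - P.Tm) :=
    intervalIntegral.integral_congr_ae <| Eventually.of_forall fun x hx => by
      rw [hz.T_init x (uIoc_of_le hs₀ ▸ hx)]
  simp only [h₁, InitialData.sigma, hz.s_init, hint]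

end IsClassicalSolution

section MinimumPrinciple

variable {P : Plant} {D : InitialData} {z : Trajectory} {E : EReal}

/-- The part of the liquid domain up to the time `t₁`. -/
def liquidUpTo (z : Trajectory) (t₁ : ℝ) : Set (ℝ × ℝ) :=
  {p | p.2 ∈ Icc 0 t₁ ∧ p.1 ∈ Icc 0 (z.s p.2)}

/-- The temperature tilted by `ε (t - x)`. It is a strict supersolution of the heat equation, and
its `x`-derivative at `x = 0` is strictly negative if heat is not extracted there. -/
def tilted (z : Trajectory) (ε : ℝ) (p : ℝ × ℝ) : ℝ := z.T p.1 p.2 + ε * (p.2 - p.1)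

theorem mem_liquidUpTo_of_mem_lateralDomain {t₁ : ℝ} {p : ℝ × ℝ} (hp : p ∈ lateralDomain z E)
    (ht : p.2 ≤ t₁) : p ∈ liquidUpTo z t₁ :=
  ⟨⟨hp.1.le, ht⟩, hp.2.2⟩

namespace IsClassicalSolution

theorem liquidUpTo_subset_closedDomain {t₁ : ℝ} (ht₁ : (t₁ : EReal) < E) :
    liquidUpTo z t₁ ⊆ closedDomain z E := fun _ hp =>
  ⟨hp.1.1, (mem_lifetime_of_le ht₁ hp.1.1 hp.1.2).2, hp.2⟩

theorem isCompact_liquidUpTo (hz : IsClassicalSolution P D z E) {t₁ : ℝ}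
    (ht₁ : (t₁ : EReal) < E) : IsCompact (liquidUpTo z t₁) := by
  have hlife : Icc 0 t₁ ⊆ lifetime E := fun r hr => mem_lifetime_of_le ht₁ hr.1 hr.2
  have himage : straighten z '' (Icc 0 1 ×ˢ Icc 0 t₁) = liquidUpTo z t₁ := by
    refine Subset.antisymm ?_ fun p hp => ?_
    · rintro _ ⟨p, hp, rfl⟩
      exact ⟨hp.2, (hz.mapsTo_straighten_closedDomain ⟨hp.1, hlife hp.2⟩).2.2⟩
    · have hs := hz.s_pos p.2 hp.1.1 (hlife hp.1).2
      exact ⟨(p.1 / z.s p.2, p.2), ⟨⟨div_nonneg hp.2.1 hs.le, (div_le_one hs).2 hp.2.2⟩, hp.1⟩,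
        Prod.ext (mul_div_cancel₀ _ hs.ne') rfl⟩
  rw [← himage]
  exact (isCompact_Icc.prod isCompact_Icc).image_of_continuousOn
    ((hz.continuousOn_straighten _).mono (prod_mono_right hlife))

theorem Tt_le_of_isMinOn_tilted (hz : IsClassicalSolution P D z E) {ε t₁ : ℝ} {p : ℝ × ℝ}
    (hp : p ∈ openDomain z E) (ht : p.2 ≤ t₁)
    (hmin : IsMinOn (tilted z ε) (liquidUpTo z t₁) p) : Tt z p.1 p.2 ≤ -ε := by
  have hderiv : HasDerivAt (fun r => tilted z ε (p.1, r)) (Tt z p.1 p.2 + ε) p.2 :=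
    ((hz.T_diff_t p hp).hasDerivAt.add
      (((hasDerivAt_id p.2).sub_const p.1).const_mul ε)).congr_deriv (by rw [mul_one]; rfl)
  have hlocal : IsLocalMinOn (fun r => tilted z ε (p.1, r)) (Iic p.2) p.2 := by
    have hopen : ∀ᶠ r in 𝓝 p.2, (p.1, r) ∈ openDomain z E :=
      (Continuous.prodMk_right p.1).continuousAt.preimage_mem_nhds (hz.openDomain_mem_nhds hp)
    filter_upwards [nhdsWithin_le_nhds hopen, self_mem_nhdsWithin] with r hr hrt
    exact hmin (mem_liquidUpTo_of_mem_lateralDomain (openDomain_subset_lateralDomain z E hr)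
      (le_trans hrt ht))
  linarith [nonpos_of_isLocalMinOn_Iic hderiv.hasDerivWithinAt hlocal]

theorem Txx_nonneg_of_isMinOn_tilted (hz : IsClassicalSolution P D z E) {ε t₁ : ℝ} {p : ℝ × ℝ}
    (hp : p ∈ openDomain z E) (ht : p.2 ≤ t₁)
    (hmin : IsMinOn (tilted z ε) (liquidUpTo z t₁) p) : 0 ≤ Txx z p.1 p.2 := by
  have hopen : ∀ᶠ y in 𝓝 p.1, (y, p.2) ∈ openDomain z E :=
    (Continuous.prodMk_left p.2).continuousAt.preimage_mem_nhds (hz.openDomain_mem_nhds hp)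
  have hderiv {y : ℝ} (hy : (y, p.2) ∈ openDomain z E) :
      HasDerivAt (fun y => tilted z ε (y, p.2)) (Tx z y p.2 + -ε) y :=
    ((hz.hasDerivAt_T_x hy).add
      (((hasDerivAt_id y).const_sub p.2).const_mul ε)).congr_deriv (by rw [mul_neg_one])
  have hlocal : IsLocalMin (fun y => tilted z ε (y, p.2)) p.1 := by
    filter_upwards [hopen] with y hy
    exact hmin (mem_liquidUpTo_of_mem_lateralDomain (openDomain_subset_lateralDomain z E hy) ht)
  have hderiv_eq : deriv (fun y => tilted z ε (y, p.2)) =ᶠ[𝓝 p.1] fun y => Tx z y p.2 + -ε := by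
    filter_upwards [hopen] with y hy using (hderiv hy).deriv
  have hsecond := deriv_deriv_nonneg_of_isLocalMin hlocal (hderiv hp).continuousAt
  rwa [hderiv_eq.deriv_eq, deriv_add_const] at hsecond

theorem not_isMinOn_tilted_of_mem_openDomain (hz : IsClassicalSolution P D z E) (hα : 0 ≤ P.α)
    {ε t₁ : ℝ} (hε : 0 < ε) {p : ℝ × ℝ} (hp : p ∈ openDomain z E) (ht : p.2 ≤ t₁) :
    ¬ IsMinOn (tilted z ε) (liquidUpTo z t₁) p := fun hmin => by
  have htime := hz.Tt_le_of_isMinOn_tilted hp ht hmin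
  have hspace := mul_nonneg hα (hz.Txx_nonneg_of_isMinOn_tilted hp ht hmin)
  linarith [hz.heat p hp]

theorem not_isMinOn_tilted_of_flux_nonneg (hz : IsClassicalSolution P D z E) (hk : 0 < P.k)
    {ε t t₁ : ℝ} (hε : 0 < ε) (ht : t ∈ openLifetime E) (htt₁ : t ≤ t₁) (hq : 0 ≤ z.q t) :
    ¬ IsMinOn (tilted z ε) (liquidUpTo z t₁) (0, t) := fun hmin => by
  have hs : 0 < z.s t := hz.s_pos t ht.1.le ht.2
  have hTx : HasDerivWithinAt (fun x => z.T x t) (Tx z 0 t) (Ici 0) 0 :=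
    (hz.T_diff_x (0, t) ⟨ht.1, ht.2, le_rfl, hs.le⟩).hasDerivWithinAt.mono_of_mem_nhdsWithin
      (Icc_mem_nhdsGE hs)
  have hderiv : HasDerivWithinAt (fun x => tilted z ε (x, t)) (Tx z 0 t + -ε) (Ici 0) 0 :=
    (hTx.add (((hasDerivWithinAt_id 0 (Ici 0)).const_sub t).const_mul ε)).congr_deriv
      (by rw [mul_neg_one])
  have hlocal : IsLocalMinOn (fun x => tilted z ε (x, t)) (Ici 0) 0 := by
    filter_upwards [Icc_mem_nhdsGE hs] with x hx
    exact hmin ⟨⟨ht.1.le, htt₁⟩, hx⟩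
  have hTx_pos : 0 < Tx z 0 t := by
    linarith [nonneg_of_isLocalMinOn_Ici hderiv hlocal]
  linarith [mul_pos hk hTx_pos, hz.flux t ht.1 ht.2]

theorem Tm_le_T_zero (hz : IsClassicalSolution P D z E) (hE : 0 < E) (hs₀ : 0 < D.s₀)
    (hT₀ : ∀ x ∈ Ioc 0 D.s₀, P.Tm ≤ D.T₀ x) : ∀ x ∈ Icc 0 D.s₀, P.Tm ≤ z.T x 0 := by
  have hcont : ContinuousOn (fun x => z.T x 0) (Icc 0 D.s₀) :=
    hz.T_cont.comp (f := fun x => (x, (0 : ℝ))) (by fun_prop)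
      fun x hx => ⟨le_rfl, hE, hx.1, hz.s_init ▸ hx.2⟩
  rw [← closure_Ioc hs₀.ne] at hcont ⊢
  exact fun x hx => le_on_closure (fun y hy => hz.T_init y hy ▸ hT₀ y hy) continuousOn_const
    hcont hx

theorem Tm_le_T_of_flux_nonneg (hz : IsClassicalSolution P D z E) (hα : 0 ≤ P.α) (hk : 0 < P.k)
    (hs₀ : 0 < D.s₀) (hT₀ : ∀ x ∈ Ioc 0 D.s₀, P.Tm ≤ D.T₀ x) {t₁ : ℝ} (ht₁ : (t₁ : EReal) < E)
    (hq : ∀ t ∈ Ioc 0 t₁, 0 ≤ z.q t) {p : ℝ × ℝ} (hp : p ∈ liquidUpTo z t₁) :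
    P.Tm ≤ z.T p.1 p.2 := by
  have hcompact := hz.isCompact_liquidUpTo ht₁
  obtain ⟨B, hB⟩ := hcompact.exists_bound_of_continuousOn continuousOn_fst
  have hlower {ε : ℝ} (hε : 0 < ε) : P.Tm ≤ z.T p.1 p.2 + ε * (p.2 - p.1 + B) := by
    have hcont : ContinuousOn (tilted z ε) (liquidUpTo z t₁) :=
      (hz.T_cont.mono (liquidUpTo_subset_closedDomain ht₁)).add (by fun_prop)
    obtain ⟨⟨x, t⟩, hm, hmin⟩ := hcompact.exists_isMinOn ⟨p, hp⟩ hcont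
    have hxB : x ≤ B := (le_abs_self x).trans (hB (x, t) hm)
    obtain ⟨⟨ht0, htt₁⟩, hx0, hxs⟩ : t ∈ Icc 0 t₁ ∧ x ∈ Icc 0 (z.s t) := hm
    have htE : (t : EReal) < E := (mem_lifetime_of_le ht₁ ht0 htt₁).2
    have hT : P.Tm ≤ z.T x t := by
      rcases ht0.eq_or_lt with rfl | ht0
      · exact hz.Tm_le_T_zero htE hs₀ hT₀ x ⟨hx0, hz.s_init ▸ hxs⟩
      rcases hx0.eq_or_lt with rfl | hx0
      · exact absurd hmin
          (hz.not_isMinOn_tilted_of_flux_nonneg hk hε ⟨ht0, htE⟩ htt₁ (hq t ⟨ht0, htt₁⟩))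
      rcases hxs.eq_or_lt with rfl | hxs
      · exact (hz.melt t ht0 htE).ge
      · exact absurd hmin
          (hz.not_isMinOn_tilted_of_mem_openDomain hα hε ⟨ht0, htE, hx0, hxs⟩ htt₁)
    have htilt : z.T x t + ε * (t - x) ≤ z.T p.1 p.2 + ε * (p.2 - p.1) := hmin hp
    have htilt_lower : ε * -B ≤ ε * (t - x) := mul_le_mul_of_nonneg_left (by linarith) hε.le
    linarith
  have hlim : Tendsto (fun ε => z.T p.1 p.2 + ε * (p.2 - p.1 + B)) (𝓝[>] 0) (𝓝 (z.T p.1 p.2)) :=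
    Tendsto.mono_left (Continuous.tendsto' (by fun_prop) _ _ (by simp)) nhdsWithin_le_nhds
  exact ge_of_tendsto hlim (eventually_nhdsWithin_of_forall fun ε hε => hlower hε)

end IsClassicalSolution

end MinimumPrinciple

section DwellTime

theorem quadratic_root_pos {e p n : ℝ} (he : 0 < e) (hn : 0 < n) :
    0 < (-p + √(p ^ 2 + 2 * e * n)) / n := by
  have hsqrt : p < √(p ^ 2 + 2 * e * n) := Real.lt_sqrt_of_sq_lt (by nlinarith [mul_pos he hn])
  exact div_pos (by linarith) hn

theorem quadratic_nonneg_of_le_root {e p n r : ℝ} (he : 0 ≤ e) (hp : 0 ≤ p) (hn : 0 < n)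
    (hr : 0 ≤ r) (hroot : r ≤ (-p + √(p ^ 2 + 2 * e * n)) / n) :
    0 ≤ e - p * r - n * r ^ 2 / 2 := by
  rw [le_div_iff₀ hn] at hroot
  have hsq : (r * n + p) ^ 2 ≤ p ^ 2 + 2 * e * n := by
    rw [← Real.sq_sqrt (show 0 ≤ p ^ 2 + 2 * e * n by positivity)]
    exact pow_le_pow_left₀ (by positivity) (by linarith) 2
  refine nonneg_of_mul_nonneg_right (a := n) ?_ hn
  linarith

/-- The standing conditions on the controller parameters. -/
structure Gains.Admissible (G : Gains) : Prop where
  c₁_pos : 0 < G.c₁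
  c₂_pos : 0 < G.c₂
  δ₁_pos : 0 < G.δ₁
  δ₂_pos : 0 < G.δ₂
  δ₂_lt_one : G.δ₂ < 1

theorem Gains.tau₁_eq_root (G : Gains) : G.tau₁ = (-(G.c₁ * (G.mu₁ + G.c₁)) +
    √((G.c₁ * (G.mu₁ + G.c₁)) ^ 2 + 2 * G.mu₁ * ((1 - G.δ₂) * G.c₁ ^ 2 * G.c₂))) /
      ((1 - G.δ₂) * G.c₁ ^ 2 * G.c₂) := by
  rw [Gains.tau₁]
  congr 4 <;> ring

theorem Gains.tau₂_eq_root (G : Gains) : G.tau₂ = (-(G.c₁ + G.cbar₂) +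
    √((G.c₁ + G.cbar₂) ^ 2 + 2 * G.δ₂ * (G.c₁ * G.cbar₂))) / (G.c₁ * G.cbar₂) := by
  rw [Gains.tau₂]
  congr 4
  ring

namespace Gains.Admissible

variable {G : Gains}

theorem one_sub_δ₂_pos (hG : G.Admissible) : 0 < 1 - G.δ₂ :=
  sub_pos.2 hG.δ₂_lt_one

theorem mu₁_pos (hG : G.Admissible) : 0 < G.mu₁ :=
  lt_min (mul_pos hG.δ₁_pos hG.c₁_pos) (mul_pos hG.one_sub_δ₂_pos hG.c₂_pos)

theorem cbar₂_pos (hG : G.Admissible) : 0 < G.cbar₂ :=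
  mul_pos (add_pos one_pos hG.δ₂_pos) hG.c₂_pos

theorem tau₁_denom_pos (hG : G.Admissible) : 0 < (1 - G.δ₂) * G.c₁ ^ 2 * G.c₂ :=
  mul_pos (mul_pos hG.one_sub_δ₂_pos (pow_pos hG.c₁_pos 2)) hG.c₂_pos

theorem tau_pos (hG : G.Admissible) : 0 < G.tau := by
  refine lt_min ?_ ?_
  · rw [tau₁_eq_root]
    exact quadratic_root_pos hG.mu₁_pos hG.tau₁_denom_pos
  · rw [tau₂_eq_root]
    exact quadratic_root_pos hG.δ₂_pos (mul_pos hG.c₁_pos hG.cbar₂_pos)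

theorem tau₁_quadratic_nonneg (hG : G.Admissible) {r : ℝ} (hr : 0 ≤ r) (hτ : r ≤ G.tau) :
    0 ≤ G.mu₁ - G.c₁ * (G.mu₁ + G.c₁) * r - (1 - G.δ₂) * G.c₁ ^ 2 * G.c₂ * r ^ 2 / 2 :=
  quadratic_nonneg_of_le_root hG.mu₁_pos.le
    (mul_pos hG.c₁_pos (add_pos hG.mu₁_pos hG.c₁_pos)).le hG.tau₁_denom_pos hr
    (G.tau₁_eq_root ▸ hτ.trans (min_le_left _ _))

theorem tau₂_quadratic_nonneg (hG : G.Admissible) {r : ℝ} (hr : 0 ≤ r) (hτ : r ≤ G.tau) :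
    0 ≤ G.δ₂ - (G.c₁ + G.cbar₂) * r - G.c₁ * G.cbar₂ * r ^ 2 / 2 :=
  quadratic_nonneg_of_le_root hG.δ₂_pos.le (add_pos hG.c₁_pos hG.cbar₂_pos).le
    (mul_pos hG.c₁_pos hG.cbar₂_pos) hr (G.tau₂_eq_root ▸ hτ.trans (min_le_right _ _))

end Gains.Admissible

end DwellTime

/-- The plant on `[0, E)` when the input `U*(a)` is held constant from the time `a` on. -/
structure IsHeld (P : Plant) (G : Gains) (D : InitialData) (z : Trajectory) (E : EReal) (a : ℝ) :
    Prop where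
  sol : IsClassicalSolution P D z E
  start_nonneg : 0 ≤ a
  flux_cont : ContinuousOn z.q (lifetime E)
  hold : ∀ t : ℝ, a ≤ t → (t : EReal) < E → HasDerivWithinAt z.q (Ustar P G z a) (Ici t) t

namespace IsHeld

variable {P : Plant} {G : Gains} {D : InitialData} {z : Trajectory} {E : EReal} {a t : ℝ}

theorem Icc_subset_lifetime (hz : IsHeld P G D z E a) (htE : (t : EReal) < E) :
    Icc a t ⊆ lifetime E :=
  fun _ hr => mem_lifetime_of_le htE (hz.start_nonneg.trans hr.1) hr.2

theorem mem_openLifetime (hz : IsHeld P G D z E a) (hat : a < t) (htE : (t : EReal) < E) :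
    t ∈ openLifetime E :=
  ⟨hz.start_nonneg.trans_lt hat, htE⟩

theorem h₂_eq (hz : IsHeld P G D z E a) (hat : a ≤ t) (htE : (t : EReal) < E) :
    h₂ z t = h₂ z a + Ustar P G z a * (t - a) := by
  have hquad := eq_quadratic_of_hasDerivWithinAt_right (f := z.q) (u := Ustar P G z a) (v := 0)
    hat (hz.flux_cont.mono (hz.Icc_subset_lifetime htE)) fun r hr => by
      rw [smul_zero, add_zero]
      have hrE := (hz.Icc_subset_lifetime htE (Ioo_subset_Icc_self hr)).2
      exact (hz.hold r hr.1.le hrE).mono Ioi_subset_Ici_self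
  rw [h₂, hquad, smul_zero, add_zero, smul_eq_mul, mul_comm, h₂]

theorem hasDerivAt_h₂ (hz : IsHeld P G D z E a) (hat : a < t) (htE : (t : EReal) < E) :
    HasDerivAt (h₂ z) (Ustar P G z a) t := by
  have haffine : HasDerivAt (fun r => h₂ z a + Ustar P G z a * (r - a)) (Ustar P G z a) t := by
    simpa using (((hasDerivAt_id t).sub_const a).const_mul (Ustar P G z a)).const_add (h₂ z a)
  refine haffine.congr_of_eventuallyEq ?_
  filter_upwards [lt_mem_nhds hat,
    (isOpen_openLifetime E).mem_nhds (hz.mem_openLifetime hat htE)] with r hr hrE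
  exact hz.h₂_eq hr.le hrE.2

theorem h₁_eq (hz : IsHeld P G D z E a) (hα : P.α ≠ 0) (hβ : P.β ≠ 0) (hat : a ≤ t)
    (htE : (t : EReal) < E) :
    h₁ P z t = h₁ P z a - h₂ z a * (t - a) - Ustar P G z a * (t - a) ^ 2 / 2 := by
  have hquad := eq_quadratic_of_hasDerivWithinAt_right (f := h₁ P z) (u := -h₂ z a)
    (v := -Ustar P G z a) hat (hz.sol.continuousOn_h₁.mono (hz.Icc_subset_lifetime htE))
    fun r hr => by
      have hrE := (hz.Icc_subset_lifetime htE (Ioo_subset_Icc_self hr)).2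
      have hderiv := hz.sol.hasDerivAt_h₁ hα hβ (hz.mem_openLifetime hr.1 hrE)
      refine (hderiv.congr_deriv ?_).hasDerivWithinAt
      rw [← h₂, hz.h₂_eq hr.1.le hrE, smul_eq_mul]
      ring
  rw [hquad, smul_eq_mul, smul_eq_mul]
  ring

theorem h₃_eq (hz : IsHeld P G D z E a) (hα : P.α ≠ 0) (hβ : P.β ≠ 0) (hat : a ≤ t)
    (htE : (t : EReal) < E) :
    h₃ P G z t =
      h₃ P G z a - G.c₂ * h₃ P G z a * (t - a) - G.c₁ * Ustar P G z a * (t - a) ^ 2 / 2 := by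
  have hUstar : Ustar P G z a + G.c₁ * h₂ z a = G.c₂ * h₃ P G z a := by
    rw [Ustar]
    ring
  rw [← hUstar, h₃, h₃, ← h₂, ← h₂, hz.h₂_eq hat htE, hz.h₁_eq hα hβ hat htE]
  ring

theorem lower_margin_eq (hz : IsHeld P G D z E a) (hα : P.α ≠ 0) (hβ : P.β ≠ 0) (hat : a ≤ t)
    (htE : (t : EReal) < E) :
    Ustar P G z t - Ustar P G z a - -G.δ₂ * G.c₂ * h₃ P G z t =
      h₂ z a * (G.c₁ ^ 2 * ((t - a) + G.cbar₂ * (t - a) ^ 2 / 2)) +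
        h₃ P G z a * (G.c₂ *
          (G.δ₂ - (G.c₁ + G.cbar₂) * (t - a) - G.c₁ * G.cbar₂ * (t - a) ^ 2 / 2)) := by
  rw [Ustar, hz.h₂_eq hat htE, hz.h₃_eq hα hβ hat htE, Ustar, Gains.cbar₂]
  ring

theorem upper_margin_eq (hz : IsHeld P G D z E a) (hα : P.α ≠ 0) (hβ : P.β ≠ 0) (hat : a ≤ t)
    (htE : (t : EReal) < E) :
    G.mu₁ * h₂ z t + G.δ₂ * G.c₂ * h₃ P G z t - (Ustar P G z t - Ustar P G z a) =
      h₂ z a * (G.mu₁ - G.c₁ * (G.mu₁ + G.c₁) * (t - a) -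
          (1 - G.δ₂) * G.c₁ ^ 2 * G.c₂ * (t - a) ^ 2 / 2) +
        h₃ P G z a * ((G.mu₁ + G.c₁) * G.c₂ * (t - a) + G.δ₂ * G.c₂ +
          (1 - G.δ₂) * (G.c₂ ^ 2 * (t - a) + G.c₁ * G.c₂ ^ 2 * (t - a) ^ 2 / 2)) := by
  rw [Ustar, hz.h₂_eq hat htE, hz.h₃_eq hα hβ hat htE, Ustar]
  ring

theorem not_violates_of_le_tau (hz : IsHeld P G D z E a) (hα : P.α ≠ 0) (hβ : P.β ≠ 0)
    (hG : G.Admissible) (h₂_nonneg : 0 ≤ h₂ z a) (h₃_nonneg : 0 ≤ h₃ P G z a) (hat : a ≤ t)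
    (htE : (t : EReal) < E) (hτ : t - a ≤ G.tau) : ¬ Violates P G z a t := by
  have hr : 0 ≤ t - a := sub_nonneg.2 hat
  have hc₁ := hG.c₁_pos
  have hc₂ := hG.c₂_pos
  have hδ₂ := hG.δ₂_pos
  have hδ₂' := hG.one_sub_δ₂_pos
  have hmu₁ := hG.mu₁_pos
  have hcbar₂ := hG.cbar₂_pos
  simp only [Violates, not_or, not_lt]
  constructor <;> rw [← sub_nonneg]
  · rw [hz.lower_margin_eq hα hβ hat htE]
    exact add_nonneg (mul_nonneg h₂_nonneg (by positivity))
      (mul_nonneg h₃_nonneg (mul_nonneg hc₂.le (hG.tau₂_quadratic_nonneg hr hτ)))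
  · rw [hz.upper_margin_eq hα hβ hat htE]
    exact add_nonneg (mul_nonneg h₂_nonneg (hG.tau₁_quadratic_nonneg hr hτ))
      (mul_nonneg h₃_nonneg (by positivity))

theorem h₃_nonneg_of_not_violates (hz : IsHeld P G D z E a) (hα : P.α ≠ 0) (hβ : P.β ≠ 0)
    (h₃_nonneg : 0 ≤ h₃ P G z a) (hat : a ≤ t) (htE : (t : EReal) < E)
    (hnv : ∀ r ∈ Ioo a t, ¬ Violates P G z a r) : 0 ≤ h₃ P G z t := by
  have hlife := hz.Icc_subset_lifetime htE
  refine nonneg_of_neg_mul_le_deriv (f := h₃ P G z) (c := G.cbar₂)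
    (f' := fun r => -Ustar P G z a + G.c₁ * -z.q r) hat
    ((hz.flux_cont.neg.add (continuousOn_const.mul hz.sol.continuousOn_h₁)).mono hlife)
    (fun r hr => ?_) (fun r hr => ?_) h₃_nonneg
  · have hrE := (hlife (Ioo_subset_Icc_self hr)).2
    exact (hz.hasDerivAt_h₂ hr.1 hrE).neg.add
      ((hz.sol.hasDerivAt_h₁ hα hβ (hz.mem_openLifetime hr.1 hrE)).const_mul G.c₁)
  · have hlower := not_lt.1 (not_or.1 (hnv r hr)).1
    rw [Ustar, h₂] at hlower
    rw [Gains.cbar₂]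
    linarith

theorem h₂_nonneg_of_not_violates (hz : IsHeld P G D z E a) (hα : P.α ≠ 0) (hβ : P.β ≠ 0)
    (hδ₂ : G.δ₂ ≤ 1) (hc₂ : 0 ≤ G.c₂) (h₂_nonneg : 0 ≤ h₂ z a) (h₃_nonneg : 0 ≤ h₃ P G z a)
    (hat : a ≤ t) (htE : (t : EReal) < E) (hnv : ∀ r ∈ Ioo a t, ¬ Violates P G z a r) :
    0 ≤ h₂ z t := by
  have hlife := hz.Icc_subset_lifetime htE
  refine nonneg_of_neg_mul_le_deriv (f := h₂ z) (c := G.c₁ + G.mu₁)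
    (f' := fun _ => Ustar P G z a) hat (hz.flux_cont.mono hlife)
    (fun r hr => hz.hasDerivAt_h₂ hr.1 (hlife (Ioo_subset_Icc_self hr)).2)
    (fun r hr => ?_) h₂_nonneg
  have hupper := not_lt.1 (not_or.1 (hnv r hr)).2
  rw [Ustar] at hupper
  have h₃_r_nonneg : 0 ≤ h₃ P G z r :=
    hz.h₃_nonneg_of_not_violates hα hβ h₃_nonneg hr.1.le (hlife (Ioo_subset_Icc_self hr)).2
      fun r' hr' => hnv r' (Ioo_subset_Ioo_right hr.2.le hr')
  have hdamping : 0 ≤ (1 - G.δ₂) * G.c₂ * h₃ P G z r :=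
    mul_nonneg (mul_nonneg (sub_nonneg.2 hδ₂) hc₂) h₃_r_nonneg
  linarith

end IsHeld

section EventTimes

theorem nat_mul_le_of_add_le_succ {u : ℕ → EReal} {τ : ℝ} (h₀ : 0 ≤ u 0)
    (hdwell : ∀ j, u j + τ ≤ u (j + 1)) (n : ℕ) : ((n * τ : ℝ) : EReal) ≤ u n := by
  induction n with
  | zero => simpa using h₀
  | succ n ih =>
    rw [Nat.cast_succ, add_one_mul, EReal.coe_add]
    exact (add_le_add_left ih _).trans (hdwell n)

theorem exists_lt_of_add_le_succ {u : ℕ → EReal} {τ : ℝ} (h₀ : 0 ≤ u 0) (hτ : 0 < τ)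
    (hdwell : ∀ j, u j + τ ≤ u (j + 1)) (R : ℝ) : ∃ n, (R : EReal) < u n := by
  obtain ⟨n, hn⟩ := exists_nat_gt (R / τ)
  exact ⟨n, (EReal.coe_lt_coe_iff.2 ((div_lt_iff₀ hτ).1 hn)).trans_le
    (nat_mul_le_of_add_le_succ h₀ hdwell n)⟩

theorem finite_setOf_le_of_monotone {X : Type*} [LinearOrder X] {u : ℕ → X} (hu : Monotone u)
    {x : X} (hx : ∃ n, x < u n) : {j | u j ≤ x}.Finite := by
  obtain ⟨n, hn⟩ := hx
  exact (finite_lt_nat n).subset fun j hj => hu.reflect_lt (lt_of_le_of_lt hj hn)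

theorem existsUnique_mem_Ico_succ {X : Type*} [LinearOrder X] {u : ℕ → X} (hu : Monotone u)
    {x : X} (h₀ : u 0 ≤ x) (hx : ∃ n, x < u n) : ∃! j, x ∈ Ico (u j) (u (j + 1)) := by
  classical
  obtain ⟨j, hj⟩ : ∃ j, Nat.find hx = j + 1 :=
    Nat.exists_eq_succ_of_ne_zero ((Nat.find_pos hx).2 h₀.not_gt).ne'
  refine ⟨j, ⟨not_lt.1 (Nat.find_min hx (by omega)), hj ▸ Nat.find_spec hx⟩, fun i hi => ?_⟩
  have hji : j < i + 1 := hu.reflect_lt ((not_lt.1 (Nat.find_min hx (by omega))).trans_lt hi.2)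
  have hij : i < j + 1 := hu.reflect_lt (hi.1.trans_lt (hj ▸ Nat.find_spec hx))
  omega

end EventTimes

namespace IsClosedLoop

variable {P : Plant} {G : Gains} {D : InitialData} {e : Execution} {j : ℕ} {a t : ℝ}

theorem time_le_time_succ (he : IsClosedLoop P G D e) (j : ℕ) : e.time j ≤ e.time (j + 1) := by
  rw [he.trigger j]
  refine le_sInf ?_
  rintro _ ⟨t, ht, rfl⟩
  exact ht.1.le

theorem monotone_time (he : IsClosedLoop P G D e) : Monotone e.time :=
  monotone_nat_of_le_succ he.time_le_time_succ

theorem time_nonneg (he : IsClosedLoop P G D e) (j : ℕ) : 0 ≤ e.time j :=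
  he.time_zero ▸ he.monotone_time j.zero_le

theorem exists_time_eq_coe (he : IsClosedLoop P G D e) (hj : e.time j ≠ ⊤) :
    ∃ a : ℝ, e.time j = a :=
  ⟨_, (EReal.coe_toReal hj (EReal.bot_lt_zero.trans_le (he.time_nonneg j)).ne').symm⟩

theorem time_succ_lt_life (he : IsClosedLoop P G D e) (hj : e.time (j + 1) ≠ ⊤) :
    e.time (j + 1) < e.life j := by
  rw [he.trigger j] at hj ⊢
  obtain ⟨_, ⟨t, ht, rfl⟩, -⟩ := sInf_lt_iff.1 (lt_top_iff_ne_top.2 hj)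
  exact (sInf_le (mem_image_of_mem _ ht)).trans_lt ht.2.1

theorem isHeld (he : IsClosedLoop P G D e) (hj : e.time j = a) :
    IsHeld P G D (e.traj j) (e.life j) a := by
  have hne : e.time j ≠ ⊤ := hj ▸ EReal.coe_ne_top a
  refine ⟨he.plant j hne, EReal.coe_nonneg.1 (hj ▸ he.time_nonneg j), he.flux_cont j hne,
    fun t hat htE => ?_⟩
  have hhold := he.hold j t (hj ▸ EReal.coe_le_coe_iff.2 hat) htE
  rwa [hj, EReal.toReal_coe] at hhold

theorem not_violates (he : IsClosedLoop P G D e) (hj : e.time j = a) (hat : a < t)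
    (htE : (t : EReal) < e.life j) (ht : (t : EReal) < e.time (j + 1)) :
    ¬ Violates P G (e.traj j) a t := fun hv => by
  refine ht.not_ge ?_
  rw [he.trigger j]
  exact sInf_le ⟨t, ⟨hj ▸ EReal.coe_lt_coe_iff.2 hat, htE, by rwa [hj, EReal.toReal_coe]⟩, rfl⟩

theorem barriers_nonneg_of_time_le (he : IsClosedLoop P G D e) (hα : P.α ≠ 0) (hβ : P.β ≠ 0)
    (hδ₂ : G.δ₂ ≤ 1) (hc₂ : 0 ≤ G.c₂) (hj : e.time j = a)
    (hbarriers : 0 ≤ h₂ (e.traj j) a ∧ 0 ≤ h₃ P G (e.traj j) a) (hat : a ≤ t)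
    (ht : (t : EReal) ≤ e.time (j + 1)) (htE : (t : EReal) < e.life j) :
    0 ≤ h₂ (e.traj j) t ∧ 0 ≤ h₃ P G (e.traj j) t := by
  have hnv : ∀ r ∈ Ioo a t, ¬ Violates P G (e.traj j) a r := fun r hr =>
    have hrt : (r : EReal) < t := EReal.coe_lt_coe_iff.2 hr.2
    he.not_violates hj hr.1 (hrt.trans htE) (hrt.trans_le ht)
  have hheld := he.isHeld hj
  exact ⟨hheld.h₂_nonneg_of_not_violates hα hβ hδ₂ hc₂ hbarriers.1 hbarriers.2 hat htE hnv,
    hheld.h₃_nonneg_of_not_violates hα hβ hbarriers.2 hat htE hnv⟩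

theorem h₂_succ_eq (he : IsClosedLoop P G D e) (hj : e.time (j + 1) ≠ ⊤) (ht₀ : 0 ≤ t)
    (ht : (t : EReal) ≤ e.time (j + 1)) : h₂ (e.traj (j + 1)) t = h₂ (e.traj j) t :=
  (he.same_past j hj t ht₀ ht).2.1

theorem h₃_succ_eq (he : IsClosedLoop P G D e) (hj : e.time (j + 1) ≠ ⊤) (ht₀ : 0 ≤ t)
    (ht : (t : EReal) ≤ e.time (j + 1)) : h₃ P G (e.traj (j + 1)) t = h₃ P G (e.traj j) t := by
  obtain ⟨hs, hq, hT⟩ := he.same_past j hj t ht₀ ht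
  have hsol := he.plant j ((he.time_le_time_succ j).trans_lt (lt_top_iff_ne_top.2 hj)).ne
  have hs₀ := (hsol.s_pos t ht₀ (ht.trans_lt (he.time_succ_lt_life hj))).le
  rw [h₃, h₃, hq, h₁_congr P hs (uIcc_of_le hs₀ ▸ hT)]

theorem barriers_nonneg_zero (he : IsClosedLoop P G D e) (hs₀ : 0 ≤ D.s₀) (hq₀ : 0 ≤ D.q₀)
    (hgain : D.q₀ ≤ G.c₁ * D.sigma P) :
    0 ≤ h₂ (e.traj 0) 0 ∧ 0 ≤ h₃ P G (e.traj 0) 0 := by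
  have hsol := he.plant 0 (he.time_zero ▸ EReal.zero_ne_top)
  rw [h₂, h₃, he.flux_init, hsol.h₁_zero hs₀]
  exact ⟨hq₀, by linarith⟩

theorem barriers_nonneg (he : IsClosedLoop P G D e) (hα : P.α ≠ 0) (hβ : P.β ≠ 0)
    (hδ₂ : G.δ₂ ≤ 1) (hc₂ : 0 ≤ G.c₂) (hs₀ : 0 ≤ D.s₀) (hq₀ : 0 ≤ D.q₀)
    (hgain : D.q₀ ≤ G.c₁ * D.sigma P) (hj : e.time j ≠ ⊤) (ht₀ : 0 ≤ t)
    (ht : (t : EReal) ≤ e.time (j + 1)) (htE : (t : EReal) < e.life j) :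
    0 ≤ h₂ (e.traj j) t ∧ 0 ≤ h₃ P G (e.traj j) t := by
  induction j generalizing t with
  | zero =>
    exact he.barriers_nonneg_of_time_le hα hβ hδ₂ hc₂ he.time_zero
      (he.barriers_nonneg_zero hs₀ hq₀ hgain) ht₀ ht htE
  | succ j ih =>
    have hpast {r : ℝ} (hr₀ : 0 ≤ r) (hr : (r : EReal) ≤ e.time (j + 1)) :
        0 ≤ h₂ (e.traj (j + 1)) r ∧ 0 ≤ h₃ P G (e.traj (j + 1)) r := by
      rw [he.h₂_succ_eq hj hr₀ hr, he.h₃_succ_eq hj hr₀ hr]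
      exact ih ((he.time_le_time_succ j).trans_lt (lt_top_iff_ne_top.2 hj)).ne hr₀ hr
        (hr.trans_lt (he.time_succ_lt_life hj))
    obtain ⟨a, ha⟩ := he.exists_time_eq_coe hj
    rcases le_total t a with hta | hat
    · exact hpast ht₀ (ha ▸ EReal.coe_le_coe_iff.2 hta)
    · exact he.barriers_nonneg_of_time_le hα hβ hδ₂ hc₂ ha
        (hpast (he.isHeld ha).start_nonneg ha.ge) hat ht htE

theorem time_add_tau_le_time_succ (he : IsClosedLoop P G D e) (hα : P.α ≠ 0) (hβ : P.β ≠ 0)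
    (hG : G.Admissible) (hs₀ : 0 ≤ D.s₀) (hq₀ : 0 ≤ D.q₀) (hgain : D.q₀ ≤ G.c₁ * D.sigma P)
    (j : ℕ) : e.time j + G.tau ≤ e.time (j + 1) := by
  rcases eq_or_ne (e.time j) ⊤ with hj | hj
  · exact le_top.trans (hj ▸ he.time_le_time_succ j)
  obtain ⟨a, ha⟩ := he.exists_time_eq_coe hj
  have hheld := he.isHeld ha
  obtain ⟨h₂_nonneg, h₃_nonneg⟩ := he.barriers_nonneg hα hβ hG.δ₂_lt_one.le hG.c₂_pos.le hs₀ hq₀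
    hgain hj hheld.start_nonneg (ha ▸ he.time_le_time_succ j) (ha ▸ he.alive j hj)
  rw [he.trigger j, ha, ← EReal.coe_add]
  refine le_sInf ?_
  rintro _ ⟨t, ⟨hat, htE, hv⟩, rfl⟩
  rw [EReal.toReal_coe] at hv
  rw [EReal.coe_le_coe_iff]
  by_contra! hlt
  exact hheld.not_violates_of_le_tau hα hβ hG h₂_nonneg h₃_nonneg (EReal.coe_lt_coe_iff.1 hat).le
    htE (sub_left_lt_of_lt_add hlt).le hv

end IsClosedLoop

theorem h₁_nonneg_of_h₂_nonneg_of_h₃_nonneg {P : Plant} {G : Gains} {z : Trajectory} {t : ℝ}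
    (hc₁ : 0 < G.c₁) (h₂_nonneg : 0 ≤ h₂ z t) (h₃_nonneg : 0 ≤ h₃ P G z t) : 0 ≤ h₁ P z t := by
  rw [h₂] at h₂_nonneg
  rw [h₃] at h₃_nonneg
  exact nonneg_of_mul_nonneg_right (a := G.c₁) (by linarith) hc₁

end StefanETC

theorem mainTheorem1_general (P : StefanETC.Plant) (G : StefanETC.Gains)
    (hα : 0 < P.α) (hβ : P.β ≠ 0) (hk : 0 < P.k) (hG : G.Admissible) :
    0 < G.tau ∧
    ∀ D : StefanETC.InitialData, 0 < D.s₀ → (∀ x ∈ Ioc 0 D.s₀, P.Tm ≤ D.T₀ x) → 0 ≤ D.q₀ →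
      D.q₀ ≤ G.c₁ * D.sigma P →
      ∀ e : StefanETC.Execution, StefanETC.IsClosedLoop P G D e →
        (∀ j, e.time j + (G.tau : EReal) ≤ e.time (j + 1)) ∧
        (∀ R : ℝ, {j : ℕ | e.time j ≤ (R : EReal)}.Finite) ∧
        (∀ t : ℝ, 0 ≤ t → (∃! j, e.Active j t) ∧
          ∀ j, e.Active j t → (t : EReal) < e.life j →
            0 ≤ StefanETC.h₁ P (e.traj j) t ∧ 0 ≤ StefanETC.h₂ (e.traj j) t ∧
            ∀ x ∈ Ioo 0 ((e.traj j).s t), 0 ≤ StefanETC.h P (e.traj j) x t) := by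
  refine ⟨hG.tau_pos, fun D hs₀ hT₀ hq₀ hgain e he => ?_⟩
  have hdwell := he.time_add_tau_le_time_succ hα.ne' hβ hG hs₀.le hq₀ hgain
  have hunbounded := StefanETC.exists_lt_of_add_le_succ (he.time_nonneg 0) hG.tau_pos hdwell
  refine ⟨hdwell, fun R => StefanETC.finite_setOf_le_of_monotone he.monotone_time (hunbounded R),
    fun t ht₀ => ⟨StefanETC.existsUnique_mem_Ico_succ he.monotone_time
      (he.time_zero.trans_le (EReal.coe_nonneg.2 ht₀)) (hunbounded t), fun j hactive htE => ?_⟩⟩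
  have hj : e.time j ≠ ⊤ := (hactive.1.trans_lt (EReal.coe_lt_top t)).ne
  have hbarriers {r : ℝ} (hr₀ : 0 ≤ r) (hrt : r ≤ t) :=
    have hrt' : (r : EReal) ≤ t := EReal.coe_le_coe_iff.2 hrt
    he.barriers_nonneg hα.ne' hβ hG.δ₂_lt_one.le hG.c₂_pos.le hs₀.le hq₀ hgain hj hr₀
      (hrt'.trans hactive.2.le) (hrt'.trans_lt htE)
  obtain ⟨h₂_nonneg, h₃_nonneg⟩ := hbarriers ht₀ le_rfl
  refine ⟨StefanETC.h₁_nonneg_of_h₂_nonneg_of_h₃_nonneg hG.c₁_pos h₂_nonneg h₃_nonneg, h₂_nonneg,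
    fun x hx => sub_nonneg.2 ?_⟩
  exact (he.plant j hj).Tm_le_T_of_flux_nonneg hα.le hk hs₀ hT₀ htE
    (fun r hr => (hbarriers hr.1.le hr.2).1) (p := (x, t))
    ⟨right_mem_Icc.2 ht₀, Ioo_subset_Icc_self hx⟩

theorem mainTheorem1 (P : StefanETC.Plant) (G : StefanETC.Gains)
    (hα : 0 < P.α) (hβ : 0 < P.β) (hk : 0 < P.k)
    (hc₁ : 0 < G.c₁) (hc₂ : 0 < G.c₂) (hδ₁ : 0 < G.δ₁) (hδ₂ : 0 < G.δ₂) (hδ₂' : G.δ₂ < 1) :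
    0 < G.tau ∧
    ∀ D : StefanETC.InitialData, D.ProfileOK P → 0 ≤ D.q₀ → D.SetpointOK P →
      D.q₀ ≤ G.c₁ * D.sigma P →
      ∀ e : StefanETC.Execution, StefanETC.IsClosedLoop P G D e →
        (∀ j, e.time j + (G.tau : EReal) ≤ e.time (j + 1)) ∧
        (∀ R : ℝ, {j : ℕ | e.time j ≤ (R : EReal)}.Finite) ∧
        (∀ t : ℝ, 0 ≤ t → (∃! j, e.Active j t) ∧
          ∀ j, e.Active j t → (t : EReal) < e.life j →
            0 ≤ StefanETC.h₁ P (e.traj j) t ∧ 0 ≤ StefanETC.h₂ (e.traj j) t ∧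
            ∀ x ∈ Set.Ioo 0 ((e.traj j).s t), 0 ≤ StefanETC.h P (e.traj j) x t) := by
  obtain ⟨hτ, hsafe⟩ := mainTheorem1_general P G hα hβ.ne' hk ⟨hc₁, hc₂, hδ₁, hδ₂, hδ₂'⟩
  exact ⟨hτ, fun D hD hq₀ _ => hsafe D hD.1 (fun x hx => hD.2.2.2.1 x (Ioc_subset_Icc_self hx)) hq₀⟩
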